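/- Let $(\mathcal A,\mathcal E)$ be an exact category in the sense of Quillen (an additive, locally small category with a class $\mathcal E$ of kernel–cokernel sequences $X\rightarrowtail Y\twoheadrightarrow Z$, called conflations, satisfying the exact axioms; the left and right maps of conflations are called inflations and deflations). Assume that $\mathcal A$ is weakly idempotent complete, i.e. every split monomorphism is an inflation. *Notation.* $\operatorname{Ext}^1(A,B)$ is the group of equivalence classes of conflations $B\rightarrowtail M\twoheadrightarrow A$. For a class $\mathcal S$ of objects, $\mathcal S^{\perp}=\{Y:\operatorname{Ext}^1(S,Y)=0\ \forall S\in\mathcal S\}$ and ${}^{\perp}\mathcal S=\{X:\operatorname{Ext}^1(X,S)=0\ \forall S\in\mathcal S\}$. For an ordinal $\lambda$, a $\lambda$-sequence of morphisms in a class $\mathcal D$ is a functor $X:\lambda\to\mathcal A$ with $X_\gamma=\operatorname{colim}_{\alpha<\gamma}X_\alpha$ for every limit ordinal $\gamma<\lambda$ and with $X_\alpha\to X_{\alpha+1}$ in $\mathcal D$ whenever $\alpha+1<\lambda$; if $\lambda>0$ and $\operatorname{colim}X$ exists, $X_0\to\operatorname{colim}_{\alpha<\lambda} X_\alpha$ is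 its transfinite composition. For a set $I$ of morphisms, $I$-cell (the class of relative $I$-cell complexes) is the class of transfinite compositions of pushouts of morphisms in $I$; $\operatorname{Cell}(I)$ is the class of objects $A$ with $(0\to A)\in I$-cell; $\operatorname{Cok}I$ is the class of objects isomorphic to the cokernel of some $i\in I$; $I$-inj is the class of morphisms having the right lifting property with respect to all $i\in I$. Let $I$ be a set of inflations such that: 1. $I$ is homological: if $A\to 0$ is in $I$-inj, then $A\in(\operatorname{Cok}I)^{\perp}$; 2. $I$ admits the small object argument: transfinite compositions of pushouts of morphisms in $I$ exist; set-indexed coproducts of morphisms in $I$ exist; and for the domain $A$ of each morphism in $I$ there is a cardinal $\kappa$ such that for every ordinal $\lambda$ with $\operatorname{cf}(\lambda)>\kappa$ and every $\lambda$-sequence $X$ of morphisms in $I$-cell, the map $\operatorname{colim}_{\alpha<\lambda}\operatorname{Hom}(A,X_\alpha)\to\operatorname{Hom}(A,\operatorname{colim}_{\alpha<\lambda}X_\alpha)$ is bijective; 3. every relative $I$-cell complex is an inflation; 4. $\operatorname{Cell}(I)$ is a class of generators: every object $A$ admits a deflation $\coprod_{s\in S}G_s\twoheadrightarrow A$ with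 $S$ a set and all $G_s\in\operatorname{Cell}(I)$. Then: (a) For every object $A$ there is a conflation $T\rightarrowtail B\twoheadrightarrow A$ with $T\in(\operatorname{Cok}I)^{\perp}$ and $B\in\operatorname{Cell}(I)$. (b) Put $\mathcal Y=(\operatorname{Cok}I)^{\perp}$ and $\mathcal X={}^{\perp}\mathcal Y$. Then $(\mathcal X,\mathcal Y)$ is a complete cotorsion pair: $\mathcal X={}^{\perp}\mathcal Y$, $\mathcal Y=\mathcal X^{\perp}$, and every object $A$ admits conflations $Y\rightarrowtail X\twoheadrightarrow A$ and $A\rightarrowtail Y'\twoheadrightarrow X'$ with $X,X'\in\mathcal X$ and $Y,Y'\in\mathcal Y$. Moreover, $\mathcal X$ consists precisely of the direct summands of objects of $\operatorname{Cell}(I)$. -/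

import Mathlib

open CategoryTheory CategoryTheory.Limits
open scoped ZeroObject

universe v u

namespace CategoryTheory

variable {C : Type u} [Category.{v} C]

section Additive

variable [Preadditive C]

/-- `f` is the left-hand morphism of a sequence in the class `P`. -/
def IsLeftMap (P : ObjectProperty (ShortComplex C)) : MorphismProperty C :=
  fun _ Y f => ∃ (Z : C) (g : Y ⟶ Z) (w : f ≫ g = 0), P (ShortComplex.mk f g w)

/-- `g` is the right-hand morphism of a sequence in the class `P`. -/
def IsRightMap (P : ObjectProperty (ShortComplex C)) : MorphismProperty C :=
  fun Y _ g => ∃ (X : C) (f : X ⟶ Y) (w : f ≫ g = 0), P (ShortComplex.mk f g w)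

variable (C) in
/-- A Quillen exact structure: a class of kernel-cokernel sequences (the conflations), closed
under isomorphism, such that identities are inflations and deflations, both classes are closed
under composition, pushouts of inflations along arbitrary morphisms exist and are inflations,
and pullbacks of deflations along arbitrary morphisms exist and are deflations. -/
structure ExactStructure where
  /-- The distinguished short exact sequences. -/
  conflation : ObjectProperty (ShortComplex C)
  conflation_of_iso : ∀ {S T : ShortComplex C}, (S ≅ T) → conflation S → conflation T
  isKernel : ∀ (S : ShortComplex C), conflation S →
    Nonempty (IsLimit (KernelFork.ofι S.f S.zero))
  isCokernel : ∀ (S : ShortComplex C), conflation S →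
    Nonempty (IsColimit (CokernelCofork.ofπ S.g S.zero))
  id_inflation : ∀ X : C, IsLeftMap conflation (𝟙 X)
  id_deflation : ∀ X : C, IsRightMap conflation (𝟙 X)
  comp_inflation : ∀ {X Y Z : C} (f : X ⟶ Y) (g : Y ⟶ Z),
    IsLeftMap conflation f → IsLeftMap conflation g → IsLeftMap conflation (f ≫ g)
  comp_deflation : ∀ {X Y Z : C} (f : X ⟶ Y) (g : Y ⟶ Z),
    IsRightMap conflation f → IsRightMap conflation g → IsRightMap conflation (f ≫ g)
  pushout_inflation : ∀ {X Y X' : C} (i : X ⟶ Y) (f : X ⟶ X'), IsLeftMap conflation i →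
    ∃ (Y' : C) (i' : X' ⟶ Y') (f' : Y ⟶ Y'), IsPushout f i i' f' ∧ IsLeftMap conflation i'
  pullback_deflation : ∀ {Y Z Z' : C} (p : Y ⟶ Z) (f : Z' ⟶ Z), IsRightMap conflation p →
    ∃ (Y' : C) (p' : Y' ⟶ Z') (f' : Y' ⟶ Y), IsPullback f' p' p f ∧ IsRightMap conflation p'

namespace ExactStructure

variable (E : ExactStructure C)

/-- The inflations of an exact structure. -/
def inflation : MorphismProperty C := IsLeftMap E.conflation

/-- The deflations of an exact structure. -/
def deflation : MorphismProperty C := IsRightMap E.conflation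

/-- Every split monomorphism is an inflation. -/
def IsWeaklyIdempotentComplete : Prop :=
  ∀ {X Y : C} (i : X ⟶ Y) (r : Y ⟶ X), i ≫ r = 𝟙 X → E.inflation i

/-- A conflation `B ↣ M ↠ A`. -/
structure Extension (A B : C) where
  /-- The middle term. -/
  M : C
  /-- The inflation. -/
  i : B ⟶ M
  /-- The deflation. -/
  p : M ⟶ A
  w : i ≫ p = 0
  conflation : E.conflation (ShortComplex.mk i p w)

/-- Two extensions of `A` by `B` are equivalent if their middle terms are isomorphic compatibly
with the morphisms from `B` and to `A`. -/
def extensionSetoid (A B : C) : Setoid (E.Extension A B) where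
  r S T := ∃ e : S.M ≅ T.M, S.i ≫ e.hom = T.i ∧ e.hom ≫ T.p = S.p
  iseqv :=
    { refl := fun S => ⟨Iso.refl _, by simp, by simp⟩
      symm := by
        rintro S T ⟨e, h₁, h₂⟩
        exact ⟨e.symm, by simp [← h₁], by simp [← h₂]⟩
      trans := by
        rintro S T U ⟨e, h₁, h₂⟩ ⟨e', h₁', h₂'⟩
        exact ⟨e ≪≫ e', by simp [← h₁', ← h₁], by simp [h₂', h₂]⟩ }

/-- The Yoneda `Ext¹(A, B)`: equivalence classes of conflations `B ↣ M ↠ A`. -/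
def YonedaExt (A B : C) : Type (max u v) := _root_.Quotient (E.extensionSetoid A B)

/-- `Ext¹(A, B) = 0`. The set `Ext¹(A, B)` contains the class of the split extension, which is the
zero of its group structure, so the group is trivial iff it has at most one element. -/
def ExtVanishes (A B : C) : Prop := Subsingleton (E.YonedaExt A B)

/-- The class of `Y` with `Ext¹(X, Y) = 0` for all `X` in `P`. -/
def rightPerp (P : ObjectProperty C) : ObjectProperty C :=
  fun Y => ∀ X : C, P X → E.ExtVanishes X Y

/-- The class of `X` with `Ext¹(X, Y) = 0` for all `Y` in `P`. -/
def leftPerp (P : ObjectProperty C) : ObjectProperty C :=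
  fun X => ∀ Y : C, P Y → E.ExtVanishes X Y

/-- `(P, Q)` is a cotorsion pair. -/
structure IsCotorsionPair (P Q : ObjectProperty C) : Prop where
  left_eq : P = E.leftPerp Q
  right_eq : Q = E.rightPerp P

/-- `(P, Q)` is a complete cotorsion pair: a cotorsion pair with enough projectives and
enough injectives. -/
structure IsCompleteCotorsionPair (P Q : ObjectProperty C) : Prop
    extends E.IsCotorsionPair P Q where
  enough_projectives : ∀ A : C, ∃ (Y X : C) (i : Y ⟶ X) (p : X ⟶ A) (w : i ≫ p = 0),
    E.conflation (ShortComplex.mk i p w) ∧ P X ∧ Q Y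
  enough_injectives : ∀ A : C, ∃ (Y X : C) (i : A ⟶ Y) (p : Y ⟶ X) (w : i ≫ p = 0),
    E.conflation (ShortComplex.mk i p w) ∧ P X ∧ Q Y

/-- `P` is a class of generators: every object is the target of a deflation from a (set-indexed)
coproduct of objects of `P`. -/
def IsGeneratingClass (P : ObjectProperty C) : Prop :=
  ∀ A : C, ∃ (S : Type v) (G : S → C) (c : Cofan G) (p : c.pt ⟶ A),
    (∀ s, P (G s)) ∧ Nonempty (IsColimit c) ∧ E.deflation p

end ExactStructure

/-- The class of objects that are a cokernel of some morphism in `I`. -/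
def cokernelClass (I : MorphismProperty C) : ObjectProperty C :=
  fun A => ∃ (X Y : C) (i : X ⟶ Y) (p : Y ⟶ A) (w : i ≫ p = 0),
    I i ∧ Nonempty (IsColimit (CokernelCofork.ofπ p w))

end Additive

section Cells

/-- A functor from a well-ordered type is a transfinite sequence of morphisms in `D` if it is
continuous at limit elements and its successor steps are in `D`. -/
structure IsTransfiniteSequence (D : MorphismProperty C) {J : Type v} [LinearOrder J]
    [SuccOrder J] [OrderBot J] [WellFoundedLT J] (F : J ⥤ C) : Prop where
  continuous : F.IsWellOrderContinuous
  map_mem : ∀ j : J, ¬ IsMax j → D (F.map (homOfLE (Order.le_succ j)))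

/-- The relative `I`-cell complexes: transfinite compositions of pushouts of morphisms in `I`. -/
def relativeCells (I : MorphismProperty C) : MorphismProperty C :=
  MorphismProperty.transfiniteCompositions.{v} I.pushouts

/-- The `I`-cell complexes: objects `A` such that `0 ⟶ A` is a relative `I`-cell complex. -/
def cellObjects [HasZeroMorphisms C] [HasZeroObject C] (I : MorphismProperty C) :
    ObjectProperty C :=
  fun A => relativeCells I (0 : (0 : C) ⟶ A)

/-- `A` is `κ`-small relative to `D`: `Hom(A, -)` preserves the colimits of all transfinite
sequences of morphisms in `D` whose length has cofinality greater than `κ`.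
(Sequences with a last term, for which the condition is automatic, are not excluded.) -/
def IsSmallRelativeTo (κ : Cardinal.{v}) (D : MorphismProperty C) (A : C) : Prop :=
  ∀ (J : Type v) [LinearOrder J] [SuccOrder J] [OrderBot J] [WellFoundedLT J] (F : J ⥤ C),
    κ < Order.cof J → IsTransfiniteSequence D F →
      PreservesColimit F (coyoneda.obj (Opposite.op A))

/-- The set `I` of morphisms admits the small object argument. -/
structure AdmitsSmallObjectArgument (I : MorphismProperty C) : Prop where
  /-- Transfinite compositions of pushouts of morphisms in `I` exist. -/
  hasColimit : ∀ (J : Type v) [LinearOrder J] [SuccOrder J] [OrderBot J] [WellFoundedLT J]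
    (F : J ⥤ C), IsTransfiniteSequence I.pushouts F → HasColimit F
  /-- Coproducts of set-indexed families of morphisms in `I` exist. -/
  hasCoproduct : ∀ (S : Type v) (X Y : S → C) (i : ∀ s, X s ⟶ Y s), (∀ s, I (i s)) →
    HasCoproduct X ∧ HasCoproduct Y
  /-- The domains of morphisms in `I` are small relative to the relative `I`-cell complexes. -/
  small_domain : ∀ {X Y : C} (i : X ⟶ Y), I i →
    ∃ κ : Cardinal.{v}, IsSmallRelativeTo κ (relativeCells I) X

end Cells

/-- A set `I` of inflations is homological if `A` lies in the right orthogonal of the cokernels of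
`I` whenever `A ⟶ 0` has the right lifting property with respect to `I`. -/
def ExactStructure.IsHomological [Preadditive C] [HasZeroObject C] (E : ExactStructure C)
    (I : MorphismProperty C) : Prop :=
  ∀ A : C, I.rlp (0 : A ⟶ (0 : C)) → E.rightPerp (cokernelClass I) A

/-- The class of direct summands of objects of `P`. -/
def directSummands [Preadditive C] [HasBinaryBiproducts C] (P : ObjectProperty C) :
    ObjectProperty C :=
  fun A => ∃ B A' : C, P B ∧ Nonempty (B ≅ A ⊞ A')

end CategoryTheory

/-!
Factor a morphism `f` as a relative `I`-cell complex followed by a morphism in `I`-inj. One cell is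
attached at each ordinal, and the lifting problems are enumerated so that every one that ever
arises is solved at some later stage; the process is stopped at a limit ordinal of large cofinality
before which all problems against earlier stages have been solved, so smallness of the domains
yields the lifting property.

For `f : 0 ⟶ A`, the morphism `p : B ⟶ A` in `I`-inj is a deflation, because a deflation onto `A`
from a coproduct of cell complexes factors through it; its kernel `T` satisfies `T ⟶ 0` in `I`-inj,
so that `T` lies in `(Cok I)^⊥` by homologicality. For `f : A ⟶ 0` one obtains the second
approximation, whose cokernel is left orthogonal to `(Cok I)^⊥` since relative cell complexes lift
against deflations with kernel in `(Cok I)^⊥`. If `A` itself is left orthogonal to `(Cok I)^⊥`, the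
first conflation splits.
-/

namespace CategoryTheory.ExactStructure

section Preadditive

variable {C : Type u} [Category.{v} C] [Preadditive C] {E : ExactStructure C}

section Conflation

variable {X Y Z : C} {f : X ⟶ Y} {g : Y ⟶ Z} {w : f ≫ g = 0}

lemma mono_of_conflation (h : E.conflation (ShortComplex.mk f g w)) : Mono f :=
  mono_of_isLimit_fork (E.isKernel _ h).some

lemma epi_of_conflation (h : E.conflation (ShortComplex.mk f g w)) : Epi g :=
  epi_of_isColimit_cofork (E.isCokernel _ h).some

lemma exists_lift_of_conflation (h : E.conflation (ShortComplex.mk f g w)) {T : C} (t : T ⟶ Y)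
    (ht : t ≫ g = 0) : ∃ l : T ⟶ X, l ≫ f = t :=
  let ⟨l, hl⟩ := KernelFork.IsLimit.lift' (E.isKernel _ h).some t ht
  ⟨l, hl⟩

lemma exists_desc_of_conflation (h : E.conflation (ShortComplex.mk f g w)) {T : C} (t : Y ⟶ T)
    (ht : f ≫ t = 0) : ∃ d : Z ⟶ T, g ≫ d = t :=
  let ⟨d, hd⟩ := CokernelCofork.IsColimit.desc' (E.isCokernel _ h).some t ht
  ⟨d, hd⟩

lemma conflation_of_deflation (w : f ≫ g = 0) (hg : E.deflation g) [Mono f]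
    (hlift : ∀ {T : C} (t : T ⟶ Y), t ≫ g = 0 → ∃ l : T ⟶ X, l ≫ f = t) :
    E.conflation (ShortComplex.mk f g w) := by
  obtain ⟨K, k, hk, hc⟩ := hg
  have := mono_of_conflation hc
  obtain ⟨a, ha⟩ := hlift k hk
  obtain ⟨b, hb⟩ := exists_lift_of_conflation hc f w
  let e : K ≅ X :=
    { hom := a
      inv := b
      hom_inv_id := by rw [← cancel_mono k, Category.assoc, hb, ha, Category.id_comp]
      inv_hom_id := by rw [← cancel_mono f, Category.assoc, ha, hb, Category.id_comp] }
  refine E.conflation_of_iso ?_ hc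
  exact ShortComplex.isoMk e (Iso.refl _) (Iso.refl _) (by simp [e, ha]) (by simp)

lemma conflation_of_inflation (w : f ≫ g = 0) (hf : E.inflation f) [Epi g]
    (hdesc : ∀ {T : C} (t : Y ⟶ T), f ≫ t = 0 → ∃ d : Z ⟶ T, g ≫ d = t) :
    E.conflation (ShortComplex.mk f g w) := by
  obtain ⟨K, k, hk, hc⟩ := hf
  have := epi_of_conflation hc
  obtain ⟨a, ha⟩ := hdesc k hk
  obtain ⟨b, hb⟩ := exists_desc_of_conflation hc g w
  let e : K ≅ Z :=
    { hom := b
      inv := a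
      hom_inv_id := by rw [← cancel_epi k, reassoc_of% hb, ha, Category.comp_id]
      inv_hom_id := by rw [← cancel_epi g, reassoc_of% ha, hb, Category.comp_id] }
  refine E.conflation_of_iso ?_ hc
  exact ShortComplex.isoMk (Iso.refl _) (Iso.refl _) e (by simp) (by simp [e, hb])

lemma exists_splitting_of_section (h : E.conflation (ShortComplex.mk f g w)) (s : Z ⟶ Y)
    (hs : s ≫ g = 𝟙 Z) : ∃ σ : (ShortComplex.mk f g w).Splitting, σ.s = s := by
  have := mono_of_conflation h
  obtain ⟨r, hr⟩ := exists_lift_of_conflation h (𝟙 Y - g ≫ s) (by simp [hs])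
  have hfr : f ≫ r = 𝟙 X := by
    rw [← cancel_mono f, Category.assoc, hr]
    simp [reassoc_of% w]
  exact ⟨{ r := r, s := s, f_r := hfr, s_g := hs, id := by simp [hr] }, rfl⟩

lemma exists_splitting_of_retraction (h : E.conflation (ShortComplex.mk f g w)) (r : Y ⟶ X)
    (hr : f ≫ r = 𝟙 X) : ∃ σ : (ShortComplex.mk f g w).Splitting, σ.r = r := by
  have := epi_of_conflation h
  obtain ⟨s, hs⟩ := exists_desc_of_conflation h (𝟙 Y - r ≫ f) (by simp [reassoc_of% hr])
  have hsg : s ≫ g = 𝟙 Z := by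
    rw [← cancel_epi g, reassoc_of% hs]
    simp [w]
  exact ⟨{ r := r, s := s, f_r := hr, s_g := hsg, id := by simp [hs] }, rfl⟩

end Conflation

variable (E) in
lemma conflation_id_zero [HasZeroObject C] (X : C) :
    E.conflation (ShortComplex.mk (𝟙 X) (0 : X ⟶ 0) comp_zero) := by
  have : Epi (0 : X ⟶ (0 : C)) := ⟨fun _ _ _ => (isZero_zero C).eq_of_src _ _⟩
  exact conflation_of_inflation comp_zero (E.id_inflation X)
    fun t ht => ⟨0, by simpa using ht.symm⟩

variable (E) in
lemma conflation_zero_id [HasZeroObject C] (X : C) :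
    E.conflation (ShortComplex.mk (0 : 0 ⟶ X) (𝟙 X) zero_comp) := by
  have : Mono (0 : (0 : C) ⟶ X) := ⟨fun _ _ _ => (isZero_zero C).eq_of_tgt _ _⟩
  exact conflation_of_deflation zero_comp (E.id_deflation X)
    fun t ht => ⟨0, by simpa using ht.symm⟩

section Pushout

variable {X Y X' Y' : C} {i : X ⟶ Y} {f : X ⟶ X'} {i' : X' ⟶ Y'} {f' : Y ⟶ Y'}

lemma inflation_of_isPushout (h : IsPushout f i i' f') (hi : E.inflation i) :
    E.inflation i' := by
  obtain ⟨P, j, g, hP, Z, q, w, hc⟩ := E.pushout_inflation i f hi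
  let e := hP.isoIsPushout _ _ h
  refine ⟨Z, e.inv ≫ q, by simp [e, w], E.conflation_of_iso ?_ hc⟩
  exact ShortComplex.isoMk (Iso.refl _) e (Iso.refl _) (by simp [e]) (by simp [e])

lemma exists_conflation_of_isPushout (h : IsPushout f i i' f') {Z : C} {q : Y ⟶ Z}
    {w : i ≫ q = 0} (hc : E.conflation (ShortComplex.mk i q w)) :
    ∃ (q' : Y' ⟶ Z) (w' : i' ≫ q' = 0), f' ≫ q' = q ∧
      E.conflation (ShortComplex.mk i' q' w') := by
  have := epi_of_conflation hc
  let q' : Y' ⟶ Z := h.desc 0 q (by simp [w])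
  have hq' : f' ≫ q' = q := h.inr_desc _ _ _
  have : Epi q' := epi_of_epi_fac hq'
  refine ⟨q', h.inl_desc _ _ _, hq',
    conflation_of_inflation _ (inflation_of_isPushout h ⟨_, _, _, hc⟩) fun t ht => ?_⟩
  obtain ⟨d, hd⟩ := exists_desc_of_conflation hc (f' ≫ t) (by rw [← h.w_assoc, ht, comp_zero])
  refine ⟨d, h.hom_ext ?_ ?_⟩
  · rw [h.inl_desc_assoc, zero_comp, ht]
  · rw [reassoc_of% hq', hd]

end Pushout

section Pullback

variable {Y Z Y' Z' : C} {p : Y ⟶ Z} {f : Z' ⟶ Z} {p' : Y' ⟶ Z'} {f' : Y' ⟶ Y}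

lemma deflation_of_isPullback (h : IsPullback f' p' p f) (hp : E.deflation p) :
    E.deflation p' := by
  obtain ⟨P, q, g, hP, X, j, w, hc⟩ := E.pullback_deflation p f hp
  let e := hP.isoIsPullback _ _ h
  refine ⟨X, j ≫ e.hom, by simp [e, w], E.conflation_of_iso ?_ hc⟩
  exact ShortComplex.isoMk (Iso.refl _) e (Iso.refl _) (by simp [e]) (by simp [e])

lemma exists_conflation_of_isPullback (h : IsPullback f' p' p f) {X : C} {j : X ⟶ Y}
    {w : j ≫ p = 0} (hc : E.conflation (ShortComplex.mk j p w)) :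
    ∃ (j' : X ⟶ Y') (w' : j' ≫ p' = 0), j' ≫ f' = j ∧
      E.conflation (ShortComplex.mk j' p' w') := by
  have := mono_of_conflation hc
  let j' : X ⟶ Y' := h.lift j 0 (by simp [w])
  have hj' : j' ≫ f' = j := h.lift_fst _ _ _
  have : Mono j' := mono_of_mono_fac hj'
  refine ⟨j', h.lift_snd _ _ _, hj',
    conflation_of_deflation _ (deflation_of_isPullback h ⟨_, _, _, hc⟩) fun t ht => ?_⟩
  obtain ⟨l, hl⟩ := exists_lift_of_conflation hc (t ≫ f')
    (by rw [Category.assoc, h.w, reassoc_of% ht, zero_comp])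
  refine ⟨l, h.hom_ext ?_ ?_⟩
  · rw [Category.assoc, hj', hl]
  · rw [Category.assoc, h.lift_snd, comp_zero, ht]

end Pullback

end Preadditive

section Biproducts

variable {C : Type u} [Category.{v} C] [Preadditive C] [HasBinaryBiproducts C]
  {E : ExactStructure C}

-- Inside `W`, the kernel of `W ⟶ S` is the sum of `Y` and the image of `A`.
lemma conflation_biprod_desc {Y W B A S : C} {j : Y ⟶ W} {p : W ⟶ B} {wp : j ≫ p = 0}
    (hp : E.conflation (ShortComplex.mk j p wp)) {i : A ⟶ B} {q : B ⟶ S} {wi : i ≫ q = 0}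
    (hi : E.conflation (ShortComplex.mk i q wi)) {h : A ⟶ W} (hh : h ≫ p = i) :
    E.conflation (ShortComplex.mk (biprod.desc j h) (p ≫ q)
      (by ext <;> simp [reassoc_of% wp, reassoc_of% hh, wi])) := by
  have := mono_of_conflation hp
  have := mono_of_conflation hi
  have : Mono (biprod.desc j h) := by
    refine Preadditive.mono_of_cancel_zero _ fun t ht => ?_
    have hsum : t ≫ biprod.fst ≫ j + t ≫ biprod.snd ≫ h = 0 := by
      simpa [biprod.desc_eq] using ht
    have hsnd : t ≫ biprod.snd = 0 := by
      rw [← cancel_mono i]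
      simpa [wp, hh] using congr($hsum ≫ p)
    have hfst : t ≫ biprod.fst = 0 := by
      rw [← cancel_mono j]
      simpa [reassoc_of% hsnd] using hsum
    ext <;> simp [hfst, hsnd]
  refine conflation_of_deflation _
    (E.comp_deflation _ _ ⟨_, _, _, hp⟩ ⟨_, _, _, hi⟩) fun t ht => ?_
  obtain ⟨a, ha⟩ := exists_lift_of_conflation hi (t ≫ p) (by simpa using ht)
  obtain ⟨y, hy⟩ := exists_lift_of_conflation hp (t - a ≫ h) (by simp [hh, ha])
  exact ⟨biprod.lift y a, by simp [hy]⟩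

variable [HasZeroObject C]

variable (E) in
lemma conflation_inl_snd (X Y : C) :
    E.conflation (ShortComplex.mk (biprod.inl : X ⟶ X ⊞ Y) biprod.snd biprod.inl_snd) := by
  obtain ⟨j, w, hj, hc⟩ :=
    exists_conflation_of_isPullback (IsPullback.of_has_biproduct X Y) (E.conflation_id_zero X)
  obtain rfl : j = biprod.inl := by ext <;> simp [hj, w]
  exact hc

lemma conflation_of_splitting {S : ShortComplex C} (σ : S.Splitting) : E.conflation S := by
  refine E.conflation_of_iso ?_ (E.conflation_inl_snd S.X₁ S.X₃)
  exact ShortComplex.isoMk (Iso.refl _) σ.isoBinaryBiproduct.symm (Iso.refl _) (by simp)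
    (by apply biprod.hom_ext' <;> simp)

lemma extVanishes_iff (A B : C) :
    E.ExtVanishes A B ↔ ∀ (M : C) (i : B ⟶ M) (p : M ⟶ A) (w : i ≫ p = 0),
      E.conflation (ShortComplex.mk i p w) → ∃ s : A ⟶ M, s ≫ p = 𝟙 A := by
  refine ⟨fun h M i p w hc => ?_, fun h => ⟨fun a b => ?_⟩⟩
  · let S : E.Extension A B := ⟨M, i, p, w, hc⟩
    let T : E.Extension A B := ⟨_, _, _, _, E.conflation_inl_snd B A⟩
    obtain ⟨e, -, he⟩ : (E.extensionSetoid A B).r T S :=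
      _root_.Quotient.exact (h.elim (_root_.Quotient.mk _ T) (_root_.Quotient.mk _ S))
    have he : e.hom ≫ p = biprod.snd := he
    exact ⟨biprod.inr ≫ e.hom, by simp [he]⟩
  · induction a using _root_.Quotient.inductionOn with | _ S
    induction b using _root_.Quotient.inductionOn with | _ T
    obtain ⟨s, hs⟩ := h _ _ _ _ S.conflation
    obtain ⟨t, ht⟩ := h _ _ _ _ T.conflation
    obtain ⟨σ, -⟩ := exists_splitting_of_section S.conflation s hs
    obtain ⟨τ, -⟩ := exists_splitting_of_section T.conflation t ht
    refine _root_.Quotient.sound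
      ⟨σ.isoBinaryBiproduct ≪≫ τ.isoBinaryBiproduct.symm, ?_, ?_⟩
    · have hσ : S.i ≫ σ.r = 𝟙 B := σ.f_r
      simp [biprod.lift_desc, reassoc_of% hσ, reassoc_of% S.w]
    · have hτ : τ.s ≫ T.p = 𝟙 A := τ.s_g
      simp [biprod.lift_desc, hτ, T.w]

lemma ExtVanishes.exists_section {A B M : C} (h : E.ExtVanishes A B) {i : B ⟶ M} {p : M ⟶ A}
    {w : i ≫ p = 0} (hc : E.conflation (ShortComplex.mk i p w)) : ∃ s : A ⟶ M, s ≫ p = 𝟙 A :=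
  (extVanishes_iff A B).1 h M i p w hc

lemma ExtVanishes.exists_splitting {A B M : C} (h : E.ExtVanishes A B) {i : B ⟶ M} {p : M ⟶ A}
    {w : i ≫ p = 0} (hc : E.conflation (ShortComplex.mk i p w)) :
    Nonempty (ShortComplex.mk i p w).Splitting :=
  let ⟨s, hs⟩ := h.exists_section hc
  let ⟨σ, _⟩ := exists_splitting_of_section hc s hs
  ⟨σ⟩

lemma IsWeaklyIdempotentComplete.deflation_of_section (hE : E.IsWeaklyIdempotentComplete)
    {X Y : C} {r : Y ⟶ X} (s : X ⟶ Y) (hs : s ≫ r = 𝟙 X) : E.deflation r := by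
  obtain ⟨K, c, w, hc⟩ := hE s r hs
  obtain ⟨σ, rfl⟩ := exists_splitting_of_retraction hc r hs
  exact ⟨K, σ.s, σ.s_r, conflation_of_splitting
    { r := c, s := s, f_r := σ.s_g, s_g := hs, id := (add_comm _ _).trans σ.id }⟩

lemma IsWeaklyIdempotentComplete.deflation_of_comp (hE : E.IsWeaklyIdempotentComplete)
    {X Y Z : C} (f : X ⟶ Y) (g : Y ⟶ Z) (hfg : E.deflation (f ≫ g)) : E.deflation g := by
  obtain ⟨L, m, wm, hm⟩ := hfg
  obtain ⟨P, pY, pX, hP, -⟩ := E.pullback_deflation (f ≫ g) g ⟨L, m, wm, hm⟩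
  obtain ⟨l, wl, hlm, hl⟩ := exists_conflation_of_isPullback hP hm
  obtain ⟨K, k, wk, hk⟩ := hE.deflation_of_section (hP.lift (𝟙 X) f (by simp)) (hP.lift_fst _ _ _)
  have hKL := conflation_biprod_desc hk hm hlm
  have := epi_of_conflation hl
  -- Pushing out along the projection kills `L`, and `pY` is the cokernel of `l : L ⟶ P`.
  have hpo : IsPushout biprod.fst (biprod.desc k l) (k ≫ pY) pY := by
    have hdesc (s : PushoutCocone (biprod.fst : K ⊞ L ⟶ K) (biprod.desc k l)) :
        ∃ d : Y ⟶ s.pt, pY ≫ d = s.inr :=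
      exists_desc_of_conflation hl s.inr (by simpa using biprod.inr ≫= s.condition.symm)
    choose d hd using hdesc
    refine ⟨⟨by ext <;> simp [wl]⟩, ⟨PushoutCocone.IsColimit.mk _ d (fun s => ?_) hd ?_⟩⟩
    · simpa [hd] using biprod.inl ≫= s.condition.symm
    · exact fun s t _ ht => by rw [← cancel_epi pY, ht, hd]
  obtain ⟨q, wq, hq, hc⟩ := exists_conflation_of_isPushout hpo hKL
  obtain rfl : q = g := by rw [← cancel_epi pY, hq, hP.w]
  exact ⟨_, _, wq, hc⟩

lemma ExtVanishes.exists_extension {S Y : C} (h : E.ExtVanishes S Y) {A B : C} {i : A ⟶ B}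
    {q : B ⟶ S} {w : i ≫ q = 0} (hc : E.conflation (ShortComplex.mk i q w)) (f : A ⟶ Y) :
    ∃ f' : B ⟶ Y, i ≫ f' = f := by
  obtain ⟨R, jY, jB, hR, -⟩ := E.pushout_inflation i f ⟨_, _, w, hc⟩
  obtain ⟨σ, wσ, -, hσ⟩ := exists_conflation_of_isPushout hR hc
  obtain ⟨τ⟩ := h.exists_splitting hσ
  have hτ : jY ≫ τ.r = 𝟙 Y := τ.f_r
  exact ⟨jB ≫ τ.r, by rw [← hR.w_assoc, hτ, Category.comp_id]⟩

lemma ExtVanishes.hasLiftingProperty {S Y : C} (hext : E.ExtVanishes S Y) {A B M N : C}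
    {i : A ⟶ B} {q : B ⟶ S} {w : i ≫ q = 0} (hi : E.conflation (ShortComplex.mk i q w))
    {j : Y ⟶ M} {p : M ⟶ N} {w' : j ≫ p = 0} (hp : E.conflation (ShortComplex.mk j p w')) :
    HasLiftingProperty i p := by
  refine ⟨fun {u v} sq => ?_⟩
  obtain ⟨W, pB, pM, hW, -⟩ := E.pullback_deflation p v ⟨_, _, w', hp⟩
  obtain ⟨jW, wj, -, hjW⟩ := exists_conflation_of_isPullback hW hp
  let h : A ⟶ W := hW.lift u i sq.w
  have hh : h ≫ pB = i := hW.lift_snd _ _ _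
  -- A retraction of `W` onto `Y` that kills `A` corresponds to a section of `pB` extending `h`.
  obtain ⟨ρ, hρ⟩ := hext.exists_extension (conflation_biprod_desc hjW hi hh) biprod.fst
  have hjρ : jW ≫ ρ = 𝟙 Y := by simpa using biprod.inl ≫= hρ
  have hhρ : h ≫ ρ = 0 := by simpa using biprod.inr ≫= hρ
  obtain ⟨σ, rfl⟩ := exists_splitting_of_retraction hjW ρ hjρ
  have hsec : σ.s ≫ pB = 𝟙 B := σ.s_g
  have his : i ≫ σ.s = h := by
    simpa [reassoc_of% hh, reassoc_of% hhρ] using h ≫= σ.id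
  exact ⟨⟨⟨σ.s ≫ pM, by rw [reassoc_of% his, hW.lift_fst],
    by rw [Category.assoc, hW.w, reassoc_of% hsec]⟩⟩⟩

lemma ExtVanishes.of_retract {A B Y : C} (h : E.ExtVanishes B Y) (r : Retract A B) :
    E.ExtVanishes A Y := by
  rw [extVanishes_iff]
  intro M j p w hc
  obtain ⟨W, pB, pM, hW, -⟩ := E.pullback_deflation p r.r ⟨_, _, w, hc⟩
  obtain ⟨_, _, -, hc'⟩ := exists_conflation_of_isPullback hW hc
  obtain ⟨s, hs⟩ := h.exists_section hc'
  exact ⟨r.i ≫ s ≫ pM, by simp [hW.w, reassoc_of% hs]⟩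

end Biproducts

end CategoryTheory.ExactStructure

lemma relativeCells_le_llp_rlp {C : Type u} [Category.{v} C] (I : MorphismProperty C) :
    relativeCells I ≤ I.rlp.llp := by
  rw [← I.rlp_pushouts]
  exact MorphismProperty.transfiniteCompositions_le_llp_rlp _

namespace CategoryTheory.ExactStructure

section Cotorsion

variable {C : Type u} [Category.{v} C] [Preadditive C] {E : ExactStructure C}

lemma rightPerp_leftPerp_rightPerp (P : ObjectProperty C) :
    E.rightPerp (E.leftPerp (E.rightPerp P)) = E.rightPerp P := by
  ext Y
  exact ⟨fun hY X hX => hY X fun Z hZ => hZ X hX, fun hY X hX => hX Y hY⟩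

variable [HasZeroObject C] {I : MorphismProperty C}

lemma rlp_to_zero_of_conflation {T M N : C} {i : T ⟶ M} {p : M ⟶ N} {w : i ≫ p = 0}
    (h : E.conflation (ShortComplex.mk i p w)) (hp : I.rlp p) : I.rlp (0 : T ⟶ (0 : C)) := by
  intro A B f hf
  refine ⟨fun {u v} sq => ?_⟩
  have := hp _ hf
  have := mono_of_conflation h
  have sq' : CommSq (u ≫ i) f p 0 := ⟨by simp [w]⟩
  obtain ⟨l, hl⟩ := exists_lift_of_conflation h sq'.lift sq'.fac_right
  exact ⟨⟨⟨l, by rw [← cancel_mono i, Category.assoc, hl, sq'.fac_left],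
    (isZero_zero C).eq_of_tgt _ _⟩⟩⟩

variable [HasBinaryBiproducts C]

lemma rlp_of_conflation (hI : I ≤ E.inflation) {T M N : C} {i : T ⟶ M} {p : M ⟶ N}
    {w : i ≫ p = 0} (h : E.conflation (ShortComplex.mk i p w))
    (hT : E.rightPerp (cokernelClass I) T) : I.rlp p := by
  intro A B f hf
  obtain ⟨S, q, hq, hc⟩ := hI _ hf
  exact (hT S ⟨_, _, f, q, hq, hf, E.isCokernel _ hc⟩).hasLiftingProperty hc h

lemma leftPerp_of_relativeCells (hI : I ≤ E.inflation) {A X S : C} {j : A ⟶ X} {q : X ⟶ S}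
    {w : j ≫ q = 0} (h : E.conflation (ShortComplex.mk j q w)) (hj : relativeCells I j) :
    E.leftPerp (E.rightPerp (cokernelClass I)) S := by
  intro Y hY
  rw [extVanishes_iff]
  intro M i p w' hc
  have := relativeCells_le_llp_rlp I _ hj p (rlp_of_conflation hI hc hY)
  have sq : CommSq 0 j p q := ⟨by simp [w]⟩
  have := epi_of_conflation h
  obtain ⟨d, hd⟩ := exists_desc_of_conflation h sq.lift sq.fac_left
  exact ⟨d, by rw [← cancel_epi q, reassoc_of% hd, sq.fac_right, Category.comp_id]⟩

lemma cellObjects_le_leftPerp (hI : I ≤ E.inflation) :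
    cellObjects I ≤ E.leftPerp (E.rightPerp (cokernelClass I)) :=
  fun B hB => leftPerp_of_relativeCells hI (E.conflation_zero_id B) hB

lemma IsGeneratingClass.deflation_of_rlp (hgen : E.IsGeneratingClass (cellObjects I))
    (hE : E.IsWeaklyIdempotentComplete) {B A : C} {p : B ⟶ A} (hp : I.rlp p) :
    E.deflation p := by
  obtain ⟨S, G, c, g, hG, ⟨hc⟩, hg⟩ := hgen A
  have hlift (s : S) : ∃ l : G s ⟶ B, l ≫ p = c.inj s ≫ g := by
    have := relativeCells_le_llp_rlp I _ (hG s) p hp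
    have sq : CommSq 0 (0 : (0 : C) ⟶ G s) p (c.inj s ≫ g) := ⟨by simp⟩
    exact ⟨sq.lift, sq.fac_right⟩
  choose l hl using hlift
  have hlp : Cofan.IsColimit.desc hc l ≫ p = g :=
    Cofan.IsColimit.hom_ext hc _ _ fun s => by rw [Cofan.IsColimit.fac_assoc, hl]
  exact hE.deflation_of_comp _ p (hlp ▸ hg)

lemma leftPerp_le_directSummands {P Q : ObjectProperty C}
    (h : ∀ A : C, ∃ (T B : C) (i : T ⟶ B) (p : B ⟶ A) (w : i ≫ p = 0),
      E.conflation (ShortComplex.mk i p w) ∧ Q T ∧ P B) :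
    E.leftPerp Q ≤ directSummands P := by
  intro A hA
  obtain ⟨T, B, i, p, w, hc, hT, hB⟩ := h A
  obtain ⟨σ⟩ := (hA T hT).exists_splitting hc
  exact ⟨B, T, hB, ⟨σ.isoBinaryBiproduct ≪≫ biprod.braiding T A⟩⟩

lemma directSummands_le_leftPerp {P Q : ObjectProperty C} (h : P ≤ E.leftPerp Q) :
    directSummands P ≤ E.leftPerp Q := by
  rintro A ⟨B, A', hB, ⟨e⟩⟩ Y hY
  exact (h B hB Y hY).of_retract
    { i := biprod.inl ≫ e.inv, r := e.hom ≫ biprod.fst }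

end Cotorsion

end CategoryTheory.ExactStructure

section TransfiniteRecursion

universe w

variable {C : Type u} [Category.{v} C] {J : Type w}

/-- The functor `F` on `K` sends the morphism `x ⟶ y` to the arrow `R (φ y) (φ x)`. In a transfinite
recursion `R j` is the row of the arrows that end in stage `j`; equality of arrows lets the
functors constructed on different initial segments be compared. -/
def RealizesArrows {K : Type*} [Preorder K] (φ : K → J) (R : J → J → Arrow C) (F : K ⥤ C) :
    Prop :=
  ∀ ⦃x y : K⦄ (f : x ⟶ y), Arrow.mk (F.map f) = R (φ y) (φ x)

namespace RealizesArrows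

variable {K : Type*} [Preorder K] {φ : K → J} {R : J → J → Arrow C} {F : K ⥤ C}

lemma congr {F' : K ⥤ C} (hF : RealizesArrows φ R F) (hF' : RealizesArrows φ R F') : F = F' :=
  Arrow.functor_ext fun _ _ f => (hF f).trans (hF' f).symm

lemma obj_eq (hF : RealizesArrows φ R F) (x : K) : F.obj x = (R (φ x) (φ x)).left :=
  congr(Comma.left $(hF (𝟙 x)))

variable [LinearOrder J]

lemma exists_glue {ψ : K → J} (hψ : Monotone ψ)
    (h : ∀ k, ∃ F : Set.Iic (ψ k) ⥤ C, RealizesArrows Subtype.val R F) :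
    ∃ G : K ⥤ C, RealizesArrows ψ R G := by
  choose F hF using h
  have hobj {a b : K} (f : a ⟶ b) : (F a).obj ⟨ψ a, le_rfl⟩ = (F b).obj ⟨ψ a, hψ (leOfHom f)⟩ :=
    ((hF a).obj_eq _).trans ((hF b).obj_eq ⟨ψ a, hψ (leOfHom f)⟩).symm
  refine ⟨{ obj := fun a => (F a).obj ⟨ψ a, le_rfl⟩
            map := fun f => eqToHom (hobj f) ≫ (F _).map (homOfLE (hψ (leOfHom f)))
            map_id := fun a => by simp
            map_comp := fun {a b c} f g => ?_ },
    fun a b f => (Arrow.arrow_mk_eqToHom_comp _ _).trans (hF b _)⟩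
  have hab : (⟨ψ a, (hψ (leOfHom f)).trans (hψ (leOfHom g))⟩ : Set.Iic (ψ c)) ≤
      ⟨ψ b, hψ (leOfHom g)⟩ := hψ (leOfHom f)
  obtain ⟨_, _, hmap⟩ := (Arrow.mk_eq_mk_iff _ _).1 ((hF c (homOfLE hab)).trans
    (hF b (x := ⟨ψ a, hψ (leOfHom f)⟩) (y := ⟨ψ b, le_rfl⟩) (homOfLE (hψ (leOfHom f)))).symm)
  rw [← homOfLE_comp hab (hψ (leOfHom g)), Functor.map_comp, hmap]
  simp

lemma exists_ofCocone {j : J} {F : Set.Iio j ⥤ C} (hF : RealizesArrows Subtype.val R F)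
    {c : Cocone F} (hlt : ∀ a : Set.Iio j, R j a = Arrow.mk (c.ι.app a))
    (hself : R j j = Arrow.mk (𝟙 c.pt)) :
    ∃ F' : Set.Iic j ⥤ C, RealizesArrows Subtype.val R F' := by
  refine ⟨SmallObject.SuccStruct.ofCocone c, ?_⟩
  rintro ⟨a, _⟩ ⟨b, hbj⟩ f
  have hab : a ≤ b := leOfHom f
  obtain hb | rfl := (Set.mem_Iic.1 hbj).lt_or_eq
  · exact (SmallObject.SuccStruct.arrowMap_ofCocone c a b hab hb).trans (hF _)
  obtain ha | rfl := hab.lt_or_eq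
  · exact (SmallObject.SuccStruct.arrowMap_ofCocone_to_top c a ha).trans (hlt ⟨a, ha⟩).symm
  · exact (congrArg Arrow.mk ((SmallObject.SuccStruct.ofCocone c).map_id _)).trans <|
      (congrArg (fun X => Arrow.mk (𝟙 X)) (SmallObject.SuccStruct.ofCocone_obj_eq_pt c)).trans
        hself.symm

end RealizesArrows

variable [LinearOrder J] [WellFoundedLT J] (step : ∀ (j : J) (F : Set.Iio j ⥤ C), Cocone F) (X₀ : C)

open scoped Classical in
/-- The arrows `X_a ⟶ X_b` of the diagram constructed by transfinite recursion from `step`,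
as a function of `b` and `a`. The object `X₀` is a junk value: by `exists_realizesArrows` the
first case always applies. -/
noncomputable def recursionArrows : J → J → Arrow C :=
  wellFounded_lt.fix fun b R =>
    if h : ∃ F : Set.Iio b ⥤ C, ∀ ⦃x y : Set.Iio b⦄ (f : x ⟶ y),
        Arrow.mk (F.map f) = R y.1 y.2 x.1 then
      fun a => if ha : a < b then Arrow.mk ((step b h.choose).ι.app ⟨a, ha⟩)
        else Arrow.mk (𝟙 (step b h.choose).pt)
    else fun _ => Arrow.mk (𝟙 X₀)

section

variable {step X₀} {j : J} {F : Set.Iio j ⥤ C}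

open scoped Classical in
lemma recursionArrows_eq (hF : RealizesArrows Subtype.val (recursionArrows step X₀) F) :
    recursionArrows step X₀ j = fun a => if ha : a < j then Arrow.mk ((step j F).ι.app ⟨a, ha⟩)
      else Arrow.mk (𝟙 (step j F).pt) := by
  have h : ∃ F : Set.Iio j ⥤ C, RealizesArrows Subtype.val (recursionArrows step X₀) F := ⟨F, hF⟩
  obtain rfl : h.choose = F := h.choose_spec.congr hF
  exact (WellFounded.fix_eq _ _ _).trans (dif_pos h)

lemma recursionArrows_of_lt (hF : RealizesArrows Subtype.val (recursionArrows step X₀) F)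
    (a : Set.Iio j) : recursionArrows step X₀ j a = Arrow.mk ((step j F).ι.app a) := by
  rw [recursionArrows_eq hF]
  exact dif_pos a.2

lemma recursionArrows_self (hF : RealizesArrows Subtype.val (recursionArrows step X₀) F) :
    recursionArrows step X₀ j j = Arrow.mk (𝟙 (step j F).pt) := by
  rw [recursionArrows_eq hF]
  exact dif_neg (lt_irrefl j)

end

lemma exists_realizesArrows (j : J) :
    ∃ F : Set.Iic j ⥤ C, RealizesArrows Subtype.val (recursionArrows step X₀) F := by
  induction j using WellFoundedLT.induction with | _ j ih
  obtain ⟨F, hF⟩ := RealizesArrows.exists_glue (K := Set.Iio j) (ψ := Subtype.val)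
    (fun _ _ h => h) fun k => ih k.1 k.2
  exact hF.exists_ofCocone (recursionArrows_of_lt hF) (recursionArrows_self hF)

theorem exists_functor_of_step [Nonempty C] :
    ∃ G : J ⥤ C, ∀ j : J, Nonempty
      (step j ((Set.principalSegIio j).monotone.functor ⋙ G) ≅
        (Set.principalSegIio j).cocone G) := by
  obtain ⟨G, hG⟩ := RealizesArrows.exists_glue monotone_id
    (exists_realizesArrows step (Classical.arbitrary C))
  refine ⟨G, fun j => ?_⟩
  have hG' : RealizesArrows Subtype.val (recursionArrows step (Classical.arbitrary C))
      ((Set.principalSegIio j).monotone.functor ⋙ G) := fun x y f => hG _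
  have hobj : (step j _).pt = G.obj j :=
    ((hG.obj_eq j).trans congr(Comma.left $(recursionArrows_self hG'))).symm
  refine ⟨Cocone.ext (eqToIso hobj) fun a => (Arrow.mk_inj _ _).1 ?_⟩
  calc Arrow.mk ((step j _).ι.app a ≫ eqToHom hobj)
    _ = Arrow.mk ((step j _).ι.app a) := Arrow.arrow_mk_comp_eqToHom _ hobj
    _ = recursionArrows step (Classical.arbitrary C) j a := (recursionArrows_of_lt hG' a).symm
    _ = Arrow.mk (G.map (homOfLE (le_of_lt a.2))) := (hG _).symm

end TransfiniteRecursion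

section Ordinals

open Order Ordinal

lemma exists_surjective_ordinal_prod :
    ∃ e : Ordinal.{v} → Ordinal.{v} × Ordinal.{v}, (∀ j, (e j).1 ≤ j) ∧ Function.Surjective e := by
  -- With `τ (2 ^ x + w) = w` for `w < 2 ^ x`, the ordinal `2 ^ (2 ^ x + ξ) + β` encodes `(β, ξ)`.
  let τ (j : Ordinal.{v}) : Ordinal.{v} := j % 2 ^ log 2 j
  have hlog {x w : Ordinal.{v}} (h : w < 2 ^ x) : log 2 (2 ^ x + w) = x := by
    simpa only [mul_one, log_one_right, add_zero] using
      log_opow_mul_add (v := 1) _root_.one_lt_two one_ne_zero h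
  have hτ {x w : Ordinal.{v}} (h : w < 2 ^ x) : τ (2 ^ x + w) = w := by
    simpa only [τ, hlog h, mul_one, mod_eq_of_lt h] using mul_add_mod_self (2 ^ x) 1 w
  have hpow (x : Ordinal.{v}) : x ≤ 2 ^ x := right_le_opow x _root_.one_lt_two
  refine ⟨fun j => (τ j, τ (log 2 j)), fun j => mod_le _ _, fun ⟨β, ξ⟩ => ?_⟩
  let x := succ (max β ξ)
  have hξ : ξ < 2 ^ x := (lt_succ_of_le (le_max_right _ _)).trans_le (hpow x)
  have hβ : β < 2 ^ (2 ^ x + ξ) :=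
    (lt_succ_of_le (le_max_left β ξ)).trans_le <| (hpow x).trans <| le_self_add.trans (hpow _)
  exact ⟨2 ^ (2 ^ x + ξ) + β, by simp only [hlog hβ, hτ hβ, hτ hξ]⟩

/-- A strictly increasing sequence of ordinals, each term of which exceeds the values of `s` below
the preceding terms; its suprema over limit ordinals are therefore closed under `s`. -/
noncomputable def closingSequence (s : Ordinal.{v} → Ordinal.{v}) (a : Ordinal.{v}) :
    Ordinal.{v} :=
  ⨆ b : Set.Iio a, succ (max (closingSequence s b) (⨆ β : Set.Iio (closingSequence s b), s β))
termination_by a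
decreasing_by exact b.2

section

variable (s : Ordinal.{v} → Ordinal.{v})

lemma max_lt_closingSequence {b a : Ordinal.{v}} (h : b < a) :
    max (closingSequence s b) (⨆ β : Set.Iio (closingSequence s b), s β) <
      closingSequence s a := by
  rw [closingSequence.eq_1 s a]
  exact succ_le_iff.1 (Ordinal.le_iSup (fun b : Set.Iio a => succ (max (closingSequence s b)
    (⨆ β : Set.Iio (closingSequence s b), s β))) ⟨b, h⟩)

lemma closingSequence_strictMono : StrictMono (closingSequence s) := fun _ _ h =>
  (le_max_left _ _).trans_lt (max_lt_closingSequence s h)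

lemma lt_closingSequence {β b a : Ordinal.{v}} (hβ : β < closingSequence s b) (h : b < a) :
    s β < closingSequence s a :=
  ((Ordinal.le_iSup (fun β : Set.Iio (closingSequence s b) => s β) ⟨β, hβ⟩).trans
    (le_max_right _ _)).trans_lt (max_lt_closingSequence s h)

lemma exists_isSuccLimit_lt_cof_forall_lt (κ : Cardinal.{v}) :
    ∃ l : Ordinal.{v}, κ < l.cof ∧ IsSuccLimit l ∧ ∀ β < l, s β < l := by
  let μ : Cardinal.{v} := succ (max κ Cardinal.aleph0)
  have hμ : μ.IsRegular := Cardinal.isRegular_succ (le_max_right _ _)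
  have hlim : IsSuccLimit μ.ord := Cardinal.isSuccLimit_ord hμ.aleph0_le
  have hcof : (⨆ a : Set.Iio μ.ord, closingSequence s a).cof = μ := by
    rw [cof_iSup_Iio (f := fun a : Set.Iio μ.ord => closingSequence s a)
      ((closingSequence_strictMono s).comp (Subtype.strictMono_coe _)) hlim.isSuccPrelimit,
      hμ.cof_ord]
  refine ⟨⨆ a : Set.Iio μ.ord, closingSequence s a, ?_, ?_, fun β hβ => ?_⟩
  · exact (lt_succ_of_le (le_max_left κ _)).trans_eq hcof.symm
  · rw [← Ordinal.one_lt_cof_iff, hcof]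
    exact Cardinal.one_lt_aleph0.trans_le hμ.aleph0_le
  · obtain ⟨a, ha⟩ := Ordinal.lt_iSup_iff.1 hβ
    exact (lt_closingSequence s ha (lt_succ a.1)).trans_le
      (Ordinal.le_iSup (fun a : Set.Iio μ.ord => closingSequence s a) ⟨_, hlim.succ_lt a.2⟩)

end

end Ordinals

section SmallObjectArgument

lemma exists_surjective_of_ordinal (α : Type*) [Small.{v} α] [Nonempty α] :
    ∃ φ : Ordinal.{v} → α, Function.Surjective φ := by
  have h : Function.Injective fun a : α =>
      Ordinal.typein (WellOrderingRel (α := Shrink.{v} α)) (equivShrink α a) :=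
    (Ordinal.typein_injective _).comp (equivShrink α).injective
  exact ⟨_, Function.invFun_surjective h⟩

variable {C : Type u} [Category.{v} C]

/-- The lifting problems of morphisms in `I` against the structure morphism of `X : Over B`. -/
def LiftingProblem (I : MorphismProperty C) {B : C} (X : Over B) : Type (max u v) :=
  Σ a : I.toSet, a.1 ⟶ Arrow.mk X.hom

namespace LiftingProblem

variable {I : MorphismProperty C} {B : C} {X Y Z : Over B} (p : LiftingProblem I X)

instance [MorphismProperty.IsSmall.{v} I] : Small.{v} (LiftingProblem I X) :=
  inferInstanceAs (Small.{v} (Σ a : I.toSet, a.1 ⟶ Arrow.mk X.hom))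

/-- The lifting problem against `Y` induced by a lifting problem against `X` and a
morphism `X ⟶ Y`. -/
def map (g : X ⟶ Y) : LiftingProblem I Y :=
  ⟨p.1, p.2 ≫ Arrow.homMk g.left (𝟙 B)⟩

/-- A lifting problem is solvable if its square admits a diagonal. -/
def IsSolvable : Prop :=
  ∃ t : p.1.1.right ⟶ X.left, p.1.1.hom ≫ t = p.2.left ∧ t ≫ X.hom = p.2.right

/-- The morphism `g : X ⟶ Y` attaches a cell along the lifting problem `p`, that is, `g` is the
pushout of the morphism in `I` along the top morphism of `p`. -/
def IsAttachment (g : X ⟶ Y) : Prop :=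
  ∃ t : p.1.1.right ⟶ Y.left, IsPushout p.2.left p.1.1.hom g.left t ∧ t ≫ Y.hom = p.2.right

variable {p}

variable (p) in
lemma map_map (g : X ⟶ Y) (h : Y ⟶ Z) : (p.map g).map h = p.map (g ≫ h) := by
  simp only [LiftingProblem.map]
  congr 1
  ext <;> simp

variable (p) in
lemma exists_map_eq (g : Z ⟶ X) (u : p.1.1.left ⟶ Z.left) (hu : u ≫ g.left = p.2.left) :
    ∃ q : LiftingProblem I Z, q.map g = p := by
  refine ⟨⟨p.1, Arrow.homMk u p.2.right ?_⟩, ?_⟩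
  · exact (u ≫= Over.w g).symm.trans <| (Category.assoc _ _ _).symm.trans <|
      (hu =≫ X.hom).trans p.2.w
  · refine Sigma.ext rfl (heq_of_eq ?_)
    ext
    · exact hu
    · exact Category.comp_id _

lemma IsSolvable.map (hp : p.IsSolvable) (g : X ⟶ Y) : (p.map g).IsSolvable := by
  obtain ⟨t, ht, ht'⟩ := hp
  refine ⟨t ≫ g.left, (Category.assoc _ _ _).symm.trans <| (ht =≫ g.left).trans ?_,
    (Category.assoc _ _ _).trans <| (t ≫= Over.w g).trans <| ht'.trans ?_⟩ <;>
    simp [LiftingProblem.map]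

lemma IsAttachment.isSolvable_map {g : X ⟶ Y} (hp : p.IsAttachment g) :
    (p.map g).IsSolvable := by
  obtain ⟨t, ht, ht'⟩ := hp
  exact ⟨t, ht.w.symm, by simpa [LiftingProblem.map] using ht'⟩

lemma IsAttachment.comp_iso {g : X ⟶ Y} (hp : p.IsAttachment g) (e : Y ≅ Z) :
    p.IsAttachment (g ≫ e.hom) := by
  obtain ⟨t, ht, ht'⟩ := hp
  refine ⟨t ≫ e.hom.left, ?_, by simp [ht']⟩
  exact ht.of_iso (Iso.refl _) (Iso.refl _) (Iso.refl _) ((Over.forget B).mapIso e)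
    (by simp) (by simp) (by simp) (by simp)

lemma IsAttachment.pushouts {g : X ⟶ Y} (hp : p.IsAttachment g) : I.pushouts g.left := by
  obtain ⟨t, ht, -⟩ := hp
  exact MorphismProperty.pushouts_mk _ ht p.1.2

variable (p) in
lemma exists_isAttachment [HasPushout p.2.left p.1.1.hom] :
    ∃ (Y : Over B) (g : X ⟶ Y), p.IsAttachment g := by
  have h := IsPushout.of_hasPushout p.2.left p.1.1.hom
  exact ⟨Over.mk (h.desc X.hom p.2.right p.2.w),
    Over.homMk (pushout.inl _ _) (h.inl_desc _ _ _), pushout.inr _ _, h, h.inr_desc _ _ _⟩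

end LiftingProblem

lemma rlp_of_isSolvable {I : MorphismProperty C} {B : C} {X : Over B}
    (h : ∀ p : LiftingProblem I X, p.IsSolvable) : I.rlp X.hom := fun P Q i hi =>
  ⟨fun {u w} sq => by
    obtain ⟨t, ht, ht'⟩ := h ⟨⟨Arrow.mk i, hi⟩, Arrow.homMk u w sq.w⟩
    exact ⟨⟨⟨t, ht, ht'⟩⟩⟩⟩

section CellularDiagrams

variable {I : MorphismProperty C}
  (hpo : ∀ ⦃P Q P' : C⦄ (i : P ⟶ Q) (f : P ⟶ P'), I i → HasPushout f i)
  {B : C}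

include hpo in
lemma exists_cocone_of_isTop {J : Type*} [PartialOrder J] {k : J} (hk : IsTop k)
    (F : J ⥤ Over B) (p : LiftingProblem I (F.obj k)) :
    ∃ c : Cocone F, p.IsAttachment (c.ι.app k) := by
  have := hpo p.1.1.hom p.2.left p.1.2
  obtain ⟨Y, g, hg⟩ := p.exists_isAttachment
  let hT : IsTerminal k := IsTerminal.ofUniqueHom (fun x => homOfLE (hk x)) fun _ _ => rfl
  have hι : ((coconeOfDiagramTerminal hT F).extend g).ι.app k = g := by simp
  exact ⟨(coconeOfDiagramTerminal hT F).extend g, hι.symm ▸ hg⟩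

lemma exists_cocone_isColimit_forget {J : Type*} [Category* J] (F : J ⥤ Over B) :
    ∃ c : Cocone F, HasColimit (F ⋙ Over.forget B) →
      Nonempty (IsColimit ((Over.forget B).mapCocone c)) := by
  by_cases hF : HasColimit (F ⋙ Over.forget B)
  · exact ⟨colimit.cocone F,
      fun _ => ⟨isColimitOfPreserves (Over.forget B) (colimit.isColimit F)⟩⟩
  · exact ⟨{ pt := Over.mk (𝟙 B)
             ι := { app := fun _ => Over.mkIdTerminal.from _
                    naturality := fun _ _ _ => Over.mkIdTerminal.hom_ext _ _ } },
      fun h => (hF h).elim⟩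

include hpo in
lemma exists_cocone_of_liftingProblems (X : Over B) {j : Ordinal.{v}} (F : Set.Iio j ⥤ Over B)
    (p : ∀ k, LiftingProblem I (F.obj k)) :
    ∃ c : Cocone F, (j = ⊥ → Nonempty (X ≅ c.pt)) ∧
      (∀ k : Set.Iio j, j = Order.succ k.1 → (p k).IsAttachment (c.ι.app k)) ∧
      (Order.IsSuccLimit j → HasColimit (F ⋙ Over.forget B) →
        Nonempty (IsColimit ((Over.forget B).mapCocone c))) := by
  obtain rfl | ⟨k, rfl⟩ | hj := Ordinal.zero_or_succ_or_isSuccLimit j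
  · have : IsEmpty (Set.Iio (0 : Ordinal.{v})) := ⟨fun x => not_lt_bot (show x.1 < ⊥ from x.2)⟩
    exact ⟨⟨X, { app := isEmptyElim, naturality := isEmptyElim }⟩, fun _ => ⟨Iso.refl X⟩,
      isEmptyElim, fun h => (h.ne_bot rfl).elim⟩
  · obtain ⟨c, hc⟩ := exists_cocone_of_isTop hpo (k := (⟨k, Order.lt_succ k⟩ : Set.Iio _))
      (fun x => Subtype.coe_le_coe.1 (Order.lt_succ_iff.1 (Set.mem_Iio.1 x.2))) F (p _)
    refine ⟨c, fun h => (Order.succ_ne_bot k h).elim, fun x hx => ?_,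
      fun h => (Order.not_isSuccLimit_succ k h).elim⟩
    obtain rfl : x = ⟨k, Order.lt_succ k⟩ := Subtype.ext (Order.succ_injective hx).symm
    exact hc
  · obtain ⟨c, hc⟩ := exists_cocone_isColimit_forget F
    exact ⟨c, fun h => (hj.ne_bot h).elim,
      fun k hk => (Order.not_isSuccLimit_succ k.1 (hk ▸ hj)).elim, fun _ => hc⟩

include hpo in
lemma exists_functor_isAttachment
    (prob : ∀ {j : Ordinal.{v}} (F : Set.Iio j ⥤ Over B) (k : Set.Iio j),
      LiftingProblem I (F.obj k)) (X : Over B) :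
    ∃ G : Ordinal.{v} ⥤ Over B, Nonempty (X ≅ G.obj ⊥) ∧
      (∀ k : Ordinal.{v}, (prob ((Set.principalSegIio (Order.succ k)).monotone.functor ⋙ G)
        ⟨k, Order.lt_succ k⟩).IsAttachment (G.map (homOfLE (Order.le_succ k)))) ∧
      (∀ k : Ordinal.{v}, Order.IsSuccLimit k →
        HasColimit ((Set.principalSegIio k).monotone.functor ⋙ G ⋙ Over.forget B) →
        Nonempty (IsColimit ((Set.principalSegIio k).cocone (G ⋙ Over.forget B)))) := by
  choose step hzero hsucc hlim using fun (j : Ordinal.{v}) (F : Set.Iio j ⥤ Over B) =>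
    exists_cocone_of_liftingProblems hpo X F (prob F)
  have : Nonempty (Over B) := ⟨X⟩
  obtain ⟨G, hG⟩ := exists_functor_of_step step
  let ε (j : Ordinal.{v}) := (hG j).some
  refine ⟨G, ?_, fun k => ?_, fun k hk hcol => ?_⟩
  · obtain ⟨i⟩ := hzero ⊥ _ rfl
    exact ⟨i ≪≫ (Cocone.forget _).mapIso (ε ⊥)⟩
  · have h := (hsucc (Order.succ k) _ ⟨k, Order.lt_succ k⟩ rfl).comp_iso
      ((Cocone.forget _).mapIso (ε (Order.succ k)))
    have hι : (step (Order.succ k) _).ι.app ⟨k, Order.lt_succ k⟩ ≫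
        ((Cocone.forget _).mapIso (ε (Order.succ k))).hom = G.map (homOfLE (Order.le_succ k)) :=
      (ε (Order.succ k)).hom.w _
    rwa [hι] at h
  · obtain ⟨hc⟩ := hlim k ((Set.principalSegIio k).monotone.functor ⋙ G) hk hcol
    exact ⟨hc.ofIsoColimit ((Cocone.functoriality _ (Over.forget B)).mapIso (ε k))⟩

/-- A diagram of objects over `B` indexed by the ordinals is an exhaustive cellular diagram if each
step attaches a cell, every lifting problem against every stage becomes solvable at a later stage,
and the limit stages are colimits whenever the latter exist. -/
structure IsExhaustiveCellular (I : MorphismProperty C) {B : C} (G : Ordinal.{v} ⥤ Over B) :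
    Prop where
  pushouts_map_succ (k : Ordinal.{v}) : I.pushouts (G.map (homOfLE (Order.le_succ k))).left
  exists_isSolvable {k : Ordinal.{v}} (p : LiftingProblem I (G.obj k)) :
    ∃ (l : Ordinal.{v}) (h : k ≤ l), (p.map (G.map (homOfLE h))).IsSolvable
  nonempty_isColimit_of_hasColimit (k : Ordinal.{v}) : Order.IsSuccLimit k →
    HasColimit ((Set.principalSegIio k).monotone.functor ⋙ G ⋙ Over.forget B) →
    Nonempty (IsColimit ((Set.principalSegIio k).cocone (G ⋙ Over.forget B)))

include hpo in
lemma exists_isExhaustiveCellular [MorphismProperty.IsSmall.{v} I]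
    [∀ X : Over B, Nonempty (LiftingProblem I X)] (X : Over B) :
    ∃ G : Ordinal.{v} ⥤ Over B, Nonempty (X ≅ G.obj ⊥) ∧ IsExhaustiveCellular I G := by
  obtain ⟨e, he, hsurj⟩ := exists_surjective_ordinal_prod.{v}
  choose enum henum using fun X : Over B => exists_surjective_of_ordinal.{v} (LiftingProblem I X)
  obtain ⟨G, hX, hatt, hlim⟩ := exists_functor_isAttachment hpo
    (fun F k => (enum (F.obj ⟨(e k).1, (he k).trans_lt k.2⟩) (e k).2).map
      (F.map (homOfLE (he k)))) X
  refine ⟨G, hX, fun k => (hatt k).pushouts, fun {k} p => ?_, hlim⟩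
  obtain ⟨ξ, rfl⟩ := henum _ p
  obtain ⟨l, hl⟩ := hsurj (k, ξ)
  obtain ⟨rfl, rfl⟩ := Prod.ext_iff.1 hl
  refine ⟨Order.succ l, (he l).trans (Order.le_succ l), ?_⟩
  rw [← homOfLE_comp (he l) (Order.le_succ l), G.map_comp, ← LiftingProblem.map_map]
  exact (hatt l).isSolvable_map

end CellularDiagrams

section TransfiniteSequences

/-- Transfinite sequences of morphisms in `D` have colimits. -/
def HasTransfiniteColimits (D : MorphismProperty C) : Prop :=
  ∀ (J : Type v) [LinearOrder J] [SuccOrder J] [OrderBot J] [WellFoundedLT J] (F : J ⥤ C),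
    IsTransfiniteSequence D F → HasColimit F

lemma isTransfiniteSequence_of_principalSeg {D : MorphismProperty C} {J : Type v} [LinearOrder J]
    [SuccOrder J] [OrderBot J] [WellFoundedLT J] {K : Type*} [LinearOrder K] [SuccOrder K]
    (φ : J <i K) (X : K ⥤ C) (hsucc : ∀ k, D (X.map (homOfLE (Order.le_succ k))))
    (hlim : ∀ k < φ.top, Order.IsSuccLimit k →
      Nonempty (IsColimit ((Set.principalSegIio k).cocone X))) :
    IsTransfiniteSequence D (φ.monotone.functor ⋙ X) where
  continuous := ⟨fun m hm => by
    obtain ⟨hc⟩ := hlim (φ m) (φ.lt_top m) (φ.isSuccLimit_apply_iff.2 hm)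
    let ψ := (Set.principalSegIio m).transInitial (φ : J ≤i K)
    exact ⟨hc.whiskerEquivalence ψ.orderIsoIio.equivalence⟩⟩
  map_mem j hj := by
    have h {a b : K} (hab : a ⋖ b) (f : a ⟶ b) : D (X.map f) := by
      obtain rfl := hab.succ_eq
      exact hsucc a
    exact h (φ.apply_covBy_apply_iff.2 (Order.covBy_succ_of_not_isMax hj)) _

lemma CategoryTheory.IsTransfiniteSequence.transfiniteCompositions_ι_bot
    {D : MorphismProperty C} {J : Type v} [LinearOrder J] [SuccOrder J] [OrderBot J]
    [WellFoundedLT J] {F : J ⥤ C}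
    (hF : IsTransfiniteSequence D F) {c : Cocone F} (hc : IsColimit c) :
    MorphismProperty.transfiniteCompositions.{v} D (c.ι.app ⊥) :=
  MorphismProperty.transfiniteCompositionsOfShape_le_transfiniteCompositions _ J _
    ⟨{ F := F
       isoBot := Iso.refl _
       isWellOrderContinuous := hF.continuous
       incl := c.ι
       isColimit := hc
       map_mem := hF.map_mem }⟩

instance (I : MorphismProperty C) : (relativeCells I).RespectsIso :=
  .of_respects_arrow_iso _ fun f g e hf => by
    rw [relativeCells, MorphismProperty.transfiniteCompositions_iff] at hf ⊢
    obtain ⟨J, _, _, _, _, hf⟩ := hf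
    exact ⟨J, _, _, _, _, (MorphismProperty.arrow_mk_iso_iff _ e).1 hf⟩

lemma transfiniteCompositions_id (D : MorphismProperty C) (X : C) :
    MorphismProperty.transfiniteCompositions.{v} D (𝟙 X) :=
  MorphismProperty.transfiniteCompositionsOfShape_le_transfiniteCompositions _
    (Shrink.{v} (Fin 1)) _
    ⟨(MorphismProperty.TransfiniteCompositionOfShape.id D X).ofOrderIso
      (orderIsoShrink.{v} (Fin 1)).symm⟩

lemma CategoryTheory.IsTransfiniteSequence.mono {D D' : MorphismProperty C} (hD : D ≤ D')
    {J : Type v} [LinearOrder J] [SuccOrder J] [OrderBot J] [WellFoundedLT J] {F : J ⥤ C}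
    (hF : IsTransfiniteSequence D F) : IsTransfiniteSequence D' F :=
  ⟨hF.continuous, fun j hj => hD _ (hF.map_mem j hj)⟩

lemma exists_isSmallRelativeTo_domains {I D : MorphismProperty C} [MorphismProperty.IsSmall.{v} I]
    (hsmall : ∀ {P Q : C} (i : P ⟶ Q), I i → ∃ κ : Cardinal.{v}, IsSmallRelativeTo κ D P) :
    ∃ κ : Cardinal.{v}, ∀ {P Q : C} (i : P ⟶ Q), I i → IsSmallRelativeTo κ D P := by
  choose κ hκ using fun a : I.toSet => hsmall a.1.hom a.2
  refine ⟨⨆ a, κ a, fun {P Q} i hi J _ _ _ _ F hJ hF => ?_⟩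
  have hle : κ ⟨Arrow.mk i, hi⟩ ≤ ⨆ a, κ a := le_ciSup Cardinal.bddAbove_of_small _
  exact hκ ⟨Arrow.mk i, hi⟩ J F (hle.trans_lt hJ) hF

end TransfiniteSequences

/-- The initial segment of the ordinals given by `o.ToType`, a type in the universe in which the
lengths of transfinite sequences live. -/
noncomputable def principalSegToType (o : Ordinal.{v}) : o.ToType <i Ordinal.{v} :=
  PrincipalSeg.relIsoTrans Ordinal.ToType.mk.symm.toRelIsoLT (Set.principalSegIio o)

namespace IsExhaustiveCellular

variable {I : MorphismProperty C} {B : C} {G : Ordinal.{v} ⥤ Over B}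

lemma nonempty_isColimit (hG : IsExhaustiveCellular I G)
    (hcolim : HasTransfiniteColimits I.pushouts) {k : Ordinal.{v}} (hk : Order.IsSuccLimit k) :
    Nonempty (IsColimit ((Set.principalSegIio k).cocone (G ⋙ Over.forget B))) := by
  induction k using WellFoundedLT.induction with | _ k ih
  have : Nonempty k.ToType := Ordinal.nonempty_toType_iff.2 hk.ne_bot
  let : OrderBot k.ToType := WellFoundedLT.toOrderBot _
  have : HasColimit ((Ordinal.ToType.mk (o := k)).symm.equivalence.functor ⋙
      (Set.principalSegIio k).monotone.functor ⋙ G ⋙ Over.forget B) :=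
    hcolim _ _ (isTransfiniteSequence_of_principalSeg (principalSegToType k) (G ⋙ Over.forget B)
      hG.pushouts_map_succ fun m hm => ih m hm)
  exact hG.nonempty_isColimit_of_hasColimit k hk
    (hasColimit_of_equivalence_comp (Ordinal.ToType.mk (o := k)).symm.equivalence)

variable (hG : IsExhaustiveCellular I G) (hcolim : HasTransfiniteColimits I.pushouts)
  {o : Ordinal.{v}}

include hG hcolim

lemma isTransfiniteSequence [OrderBot o.ToType] : IsTransfiniteSequence I.pushouts
    ((principalSegToType o).monotone.functor ⋙ G ⋙ Over.forget B) :=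
  isTransfiniteSequence_of_principalSeg _ _ hG.pushouts_map_succ
    fun _ _ hk => hG.nonempty_isColimit hcolim hk

lemma nonempty_isColimit_toType (ho : Order.IsSuccLimit o) :
    Nonempty (IsColimit ((principalSegToType o).cocone (G ⋙ Over.forget B))) := by
  obtain ⟨hc⟩ := hG.nonempty_isColimit hcolim ho
  exact ⟨hc.whiskerEquivalence (principalSegToType o).orderIsoIio.equivalence⟩

lemma relativeCells_map_bot (ho : Order.IsSuccLimit o) :
    relativeCells I (G.map (homOfLE (bot_le : ⊥ ≤ o))).left := by
  have : Nonempty o.ToType := Ordinal.nonempty_toType_iff.2 ho.ne_bot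
  let : OrderBot o.ToType := WellFoundedLT.toOrderBot _
  obtain ⟨hc⟩ := hG.nonempty_isColimit_toType hcolim ho
  have h : ∀ k (hk : k ≤ o), k = ⊥ → relativeCells I (G.map (homOfLE hk)).left →
      relativeCells I (G.map (homOfLE (bot_le : ⊥ ≤ o))).left := by
    rintro _ _ rfl h
    exact h
  exact h _ _ (principalSegToType o).map_bot
    ((hG.isTransfiniteSequence hcolim).transfiniteCompositions_ι_bot hc)

/-- A square against the structure morphism of `G.obj o` factors through an earlier stage by
smallness, and is solved before `o` is reached. -/
lemma rlp_hom {κ : Cardinal.{v}}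
    (hκ : ∀ {P Q : C} (i : P ⟶ Q), I i → IsSmallRelativeTo κ (relativeCells I) P)
    (ho : Order.IsSuccLimit o) (hoκ : κ < o.cof)
    (hsolve : ∀ k < o, ∀ p : LiftingProblem I (G.obj k),
      ∃ (l : Ordinal.{v}) (h : k ≤ l), l < o ∧ (p.map (G.map (homOfLE h))).IsSolvable) :
    I.rlp (G.obj o).hom := by
  refine rlp_of_isSolvable fun p => ?_
  have : Nonempty o.ToType := Ordinal.nonempty_toType_iff.2 ho.ne_bot
  let : OrderBot o.ToType := WellFoundedLT.toOrderBot _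
  obtain ⟨hc⟩ := hG.nonempty_isColimit_toType hcolim ho
  have := hκ p.1.1.hom p.1.2 o.ToType _ (by rwa [Ordinal.cof_toType])
    ((hG.isTransfiniteSequence hcolim).mono
      (MorphismProperty.le_transfiniteCompositions I.pushouts))
  obtain ⟨k, u, hu⟩ := Types.jointly_surjective_of_isColimit
    (isColimitOfPreserves (coyoneda.obj (Opposite.op p.1.1.left)) hc) p.2.left
  have hk : principalSegToType o k < o := (principalSegToType o).lt_top k
  obtain ⟨q, rfl⟩ := p.exists_map_eq (G.map (homOfLE hk.le)) u hu
  obtain ⟨l, hkl, hl, hq⟩ := hsolve _ hk q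
  rw [← homOfLE_comp hkl hl.le, G.map_comp, ← LiftingProblem.map_map]
  exact hq.map _

end IsExhaustiveCellular

theorem exists_relativeCells_comp_rlp [HasZeroMorphisms C] {I : MorphismProperty C}
    [MorphismProperty.IsSmall.{v} I]
    (hpo : ∀ ⦃P Q P' : C⦄ (i : P ⟶ Q) (f : P ⟶ P'), I i → HasPushout f i)
    (hcolim : HasTransfiniteColimits I.pushouts)
    (hsmall : ∀ {P Q : C} (i : P ⟶ Q), I i →
      ∃ κ : Cardinal.{v}, IsSmallRelativeTo κ (relativeCells I) P)
    {A B : C} (f : A ⟶ B) :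
    ∃ (X : C) (j : A ⟶ X) (p : X ⟶ B), relativeCells I j ∧ I.rlp p ∧ j ≫ p = f := by
  cases isEmpty_or_nonempty I.toSet with
  | inl hI =>
    exact ⟨A, 𝟙 A, f, transfiniteCompositions_id _ A,
      fun P Q i hi => (hI.false ⟨Arrow.mk i, hi⟩).elim, Category.id_comp f⟩
  | inr hI =>
    have (X : Over B) : Nonempty (LiftingProblem I X) := ⟨hI.some, Arrow.homMk 0 0 (by simp)⟩
    obtain ⟨G, ⟨ε⟩, hG⟩ := exists_isExhaustiveCellular hpo (Over.mk f)
    obtain ⟨κ, hκ⟩ := exists_isSmallRelativeTo_domains hsmall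
    choose l hkl hl using @hG.exists_isSolvable
    obtain ⟨o, hoκ, ho, hlo⟩ :=
      exists_isSuccLimit_lt_cof_forall_lt (fun k => ⨆ p : LiftingProblem I (G.obj k), l p) κ
    refine ⟨(G.obj o).left, ε.hom.left ≫ (G.map (homOfLE bot_le)).left, (G.obj o).hom,
      ?_, hG.rlp_hom hcolim hκ ho hoκ fun k hk p => ⟨l p, hkl p, ?_, hl p⟩, by simp⟩
    · exact MorphismProperty.RespectsIso.precomp _ ((Over.forget B).mapIso ε).hom _
        (hG.relativeCells_map_bot hcolim ho)
    · exact (Ordinal.le_iSup _ p).trans_lt (hlo k hk)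

end SmallObjectArgument

theorem theorem3p7_general {C : Type u} [Category.{v} C] [Preadditive C] [HasZeroObject C]
    [HasBinaryBiproducts C] (E : ExactStructure C) (hE : E.IsWeaklyIdempotentComplete)
    (I : MorphismProperty C) [MorphismProperty.IsSmall.{v} I] (hI : I ≤ E.inflation)
    (hhom : E.IsHomological I) (hcolim : HasTransfiniteColimits I.pushouts)
    (hsmall : ∀ {P Q : C} (i : P ⟶ Q), I i →
      ∃ κ : Cardinal.{v}, IsSmallRelativeTo κ (relativeCells I) P)
    (hcell : relativeCells I ≤ E.inflation) (hgen : E.IsGeneratingClass (cellObjects I)) :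
    (∀ A : C, ∃ (T B : C) (i : T ⟶ B) (p : B ⟶ A) (w : i ≫ p = 0),
      E.conflation (ShortComplex.mk i p w) ∧
        E.rightPerp (cokernelClass I) T ∧ cellObjects I B) ∧
    E.IsCompleteCotorsionPair (E.leftPerp (E.rightPerp (cokernelClass I)))
      (E.rightPerp (cokernelClass I)) ∧
    E.leftPerp (E.rightPerp (cokernelClass I)) = directSummands (cellObjects I) := by
  have hpo : ∀ ⦃P Q P' : C⦄ (i : P ⟶ Q) (f : P ⟶ P'), I i → HasPushout f i := fun P Q P' i f hi =>
    have ⟨_, _, _, h, _⟩ := E.pushout_inflation i f (hI _ hi)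
    h.hasPushout
  have hproj (A : C) : ∃ (T B : C) (i : T ⟶ B) (p : B ⟶ A) (w : i ≫ p = 0),
      E.conflation (ShortComplex.mk i p w) ∧
        E.rightPerp (cokernelClass I) T ∧ cellObjects I B := by
    obtain ⟨B, j, p, hj, hp, -⟩ := exists_relativeCells_comp_rlp hpo hcolim hsmall (0 : 0 ⟶ A)
    obtain ⟨T, i, w, hc⟩ := hgen.deflation_of_rlp hE hp
    obtain rfl : j = 0 := (isZero_zero C).eq_of_src _ _
    exact ⟨T, B, i, p, w, hc, hhom T (ExactStructure.rlp_to_zero_of_conflation hc hp), hj⟩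
  have hcellPerp := ExactStructure.cellObjects_le_leftPerp hI
  refine ⟨hproj, ⟨⟨rfl, (ExactStructure.rightPerp_leftPerp_rightPerp _).symm⟩, fun A => ?_,
    fun A => ?_⟩, (ExactStructure.leftPerp_le_directSummands hproj).antisymm
      (ExactStructure.directSummands_le_leftPerp hcellPerp)⟩
  · obtain ⟨T, B, i, p, w, hc, hT, hB⟩ := hproj A
    exact ⟨T, B, i, p, w, hc, hcellPerp _ hB, hT⟩
  · obtain ⟨Y, j, p, hj, hp, -⟩ := exists_relativeCells_comp_rlp hpo hcolim hsmall (0 : A ⟶ 0)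
    obtain ⟨X, q, w, hc⟩ := hcell _ hj
    obtain rfl : p = 0 := (isZero_zero C).eq_of_tgt _ _
    exact ⟨Y, X, j, q, w, hc, ExactStructure.leftPerp_of_relativeCells hI hc hj, hhom Y hp⟩

theorem theorem3p7 {C : Type u} [Category.{v} C] [Preadditive C] [HasZeroObject C]
    [HasBinaryBiproducts C] (E : ExactStructure C) (hE : E.IsWeaklyIdempotentComplete)
    (I : MorphismProperty C) [MorphismProperty.IsSmall.{v} I] (hI : I ≤ E.inflation)
    (hhom : E.IsHomological I) (hsmall : AdmitsSmallObjectArgument I)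
    (hcell : relativeCells I ≤ E.inflation) (hgen : E.IsGeneratingClass (cellObjects I)) :
    (∀ A : C, ∃ (T B : C) (i : T ⟶ B) (p : B ⟶ A) (w : i ≫ p = 0),
      E.conflation (ShortComplex.mk i p w) ∧
        E.rightPerp (cokernelClass I) T ∧ cellObjects I B) ∧
    E.IsCompleteCotorsionPair (E.leftPerp (E.rightPerp (cokernelClass I)))
      (E.rightPerp (cokernelClass I)) ∧
    E.leftPerp (E.rightPerp (cokernelClass I)) = directSummands (cellObjects I) :=
  theorem3p7_general E hE I hI hhom hsmall.hasColimit hsmall.small_domain hcell hgen
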